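/- Let $\Omega=\{0,1\}^{\mathbb N}$ with the product topology and its Borel $\sigma$-algebra. A \emph{theory} is a Borel probability measure on $\Omega$; the set $\Delta(\Omega)$ of theories carries the weak-$^*$ topology. For a finite sequence $\sigma=(s_0,\dots,s_{n-1})\in\{0,1\}^n$ (possibly empty), let $N(\sigma)\subseteq\Omega$ be the set of infinite sequences that extend $\sigma$. A theory $\mu$ is \emph{exchangeable} if $\mu(N(s_0,\dots,s_{n-1}))=\mu(N(s_{\pi(0)},\dots,s_{\pi(n-1)}))$ for every $n\ge 0$, every $(s_0,\dots,s_{n-1})\in\{0,1\}^n$ and every permutation $\pi$ of $\{0,\dots,n-1\}$. Let $\Gamma\subseteq\Delta(\Omega)$ be the set of exchangeable theories, with the subspace topology. For a theory $\mu$ and $x=(s_0,s_1,\dots)\in\Omega$ with $\mu(N(s_0,\dots,s_{n-1}))>0$, the \emph{forecast} of $\mu$ over $x$ at period $n$ is $$p_n=\frac{\mu(N(s_0,\dots,s_{n-1},1))}{\mu(N(s_0,\dots,s_{n-1}))}\in[0,1],$$ the conditional probability that the outcome of period $n$ is $1$. A \emph{prequential test} is a Borel function $T:([0,1]\times\{0,1\})^{\mathbb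 N}\to\{\mathrm{FAIL},\mathrm{PASS}\}$. A theory $\mu$ \emph{passes $T$ over} $x$ if $\mu(N(s_0,\dots,s_{n-1}))>0$ for every $n\ge 0$ and $T(p_0,s_0,p_1,s_1,\dots)=\mathrm{PASS}$, where $p_k$ is the forecast of $\mu$ over $x$ at period $k$. Let $A_\mu^{(T)}\subseteq\Omega$ be the set of all $x$ over which $\mu$ passes $T$. \textbf{Theorem.} There exists a prequential test $T$ such that (1) $T$ accepts the data-generating process in $\Gamma$ with probability $1$: $\mu(A_\mu^{(T)})=1$ for every $\mu\in\Gamma$; and (2) $T$ is strongly non-manipulable with respect to $\Gamma$: for every Borel probability measure $\zeta$ on $\Gamma$, the set of all $\mu\in\Gamma$ with $$(\zeta\otimes\mu)\bigl(\{(\nu,x)\in\Gamma\times\Omega : x\in A_\nu^{(T)}\}\bigr)=0$$ is co-meager in $\Gamma$, i.e. it contains a countable intersection of dense open subsets of the topological space $\Gamma$. -/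

import Mathlib

open MeasureTheory

/-- Realizations: infinite sequences of outcomes, with the product topology and
product (equivalently, Borel) σ-algebra. -/
abbrev Realization : Type := ℕ → Fin 2

/-- Theories: probability measures over realizations, with the weak-* topology. -/
abbrev Theory : Type := ProbabilityMeasure Realization

/-- A paradigm is a set of theories. -/
abbrev Paradigm : Type := Set Theory

/-- `cyl σ` is the set `N(σ)` of all realizations that extend the partial realization `σ`. -/
def cyl {n : ℕ} (σ : Fin n → Fin 2) : Set Realization :=
  {x | ∀ i : Fin n, x i = σ i}

/-- The partial realization of length `n` along `x`. -/
def initialSegment (x : Realization) (n : ℕ) : Fin n → Fin 2 := fun i => x i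

theorem cyl_snoc_subset {n : ℕ} (σ : Fin n → Fin 2) (s : Fin 2) :
    cyl (Fin.snoc σ s : Fin (n + 1) → Fin 2) ⊆ cyl σ := by
  intro x hx i
  have h := hx i.castSucc
  simpa using h

/-- The forecast of `μ` over `x` at period `n`. A forecast `p`, a probability measure
on `{0, 1}`, is identified with the number `p[1]` of the unit interval. The forecast is
meaningful only if `μ (cyl (initialSegment x n)) > 0` (otherwise its value is `0`). -/
noncomputable def forecast (μ : Theory) (x : Realization) (n : ℕ) : unitInterval :=
  ⟨(μ : Measure Realization).real
        (cyl (Fin.snoc (initialSegment x n) 1 : Fin (n + 1) → Fin 2)) /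
      (μ : Measure Realization).real (cyl (initialSegment x n)),
    div_nonneg measureReal_nonneg measureReal_nonneg,
    div_le_one_of_le₀ (measureReal_mono (cyl_snoc_subset _ _)) measureReal_nonneg⟩

/-- The verdict of a test. -/
inductive Verdict : Type
  | fail
  | pass

/-- All sets of verdicts are Borel. -/
instance : MeasurableSpace Verdict := ⊤

/-- A prequential test: a Borel function of the sequence of pairs
`(p₀, s₀), (p₁, s₁), …` of forecasts and outcomes. -/
structure PrequentialTest where
  /-- the verdict on a sequence of forecasts and outcomes -/
  verdict : (ℕ → unitInterval × Fin 2) → Verdict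
  /-- the test is a Borel function -/
  measurable_verdict : Measurable verdict

/-- The theory `μ` passes the test `T` over the realization `x`. -/
def Passes (T : PrequentialTest) (μ : Theory) (x : Realization) : Prop :=
  (∀ n : ℕ, 0 < (μ : Measure Realization) (cyl (initialSegment x n))) ∧
    T.verdict (fun n => (forecast μ x n, x n)) = Verdict.pass

/-- The acceptance set of `μ` under `T`. -/
def acceptanceSet (T : PrequentialTest) (μ : Theory) : Set Realization :=
  {x | Passes T μ x}

/-- The test accepts the data-generating law in the paradigm `Γ` with probability `q`. -/
def AcceptsWithProbability (T : PrequentialTest) (Γ : Paradigm) (q : ENNReal) : Prop :=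
  ∀ μ ∈ Γ, q ≤ (μ : Measure Realization) (acceptanceSet T μ)

/-- Strong non-manipulability: for every probability distribution `ζ` over `Γ`, the set of
`μ` in `Γ` against which the randomized theory passes with probability `0` is co-meager in
the topological space `Γ`. The σ-algebra on `Γ` is generated by the evaluations `ν ↦ ν B`
(`B` Borel); it is the Borel σ-algebra of the weak-* topology, as `Realization` is Polish. -/
def StronglyNonManipulable (T : PrequentialTest) (Γ : Paradigm) : Prop :=
  ∀ ζ : ProbabilityMeasure Γ,
    {μ : Γ | ((ζ : Measure Γ).prod ((μ : Theory) : Measure Realization))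
      {z : Γ × Realization | z.2 ∈ acceptanceSet T z.1} = 0} ∈ residual Γ

/-- The paradigm of exchangeable theories. -/
def exchangeable : Paradigm :=
  {μ | ∀ (n : ℕ) (σ : Fin n → Fin 2) (π : Equiv.Perm (Fin n)),
    (μ : Measure Realization) (cyl σ) = (μ : Measure Realization) (cyl (fun i => σ (π i)))}

open Filter Topology

/-! Exchangeable data have a limiting frequency almost surely, and the test looks only at this
number. A theory `ν` passes when it lies in a meager set that depends on `ν` and carries the `ν`-law
of the limiting frequency: the rationals, together with, for each `k`, the points outside balls
around all rationals so small that, without their centres, they have total `ν`-probability at most a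
constant times `2⁻¹ ^ k`. Removing the centres takes care of atoms at rationals;
`measure_not_plausible` shows that `ν` passes on its own data.

A generic exchangeable `μ` gives probability zero to any fixed closed nowhere dense set `F` of
limiting frequencies (`residual_measure_limitFrequency_mem_eq_zero`). Up to a uniform error the
event depends on finitely many outcomes, so having small probability is an open condition. It is
dense because mixtures of coins with biases outside `F` approximate every exchangeable theory, by a
finite form of de Finetti's theorem (`tendsto_coinMixture`).

A random `ν` has random radii, but outside a set of small `ζ`-probability they are bounded below by
fixed positive numbers. One closed nowhere dense set then serves for all remaining `ν`, and
countably many such sets suffice (`residual_prod_plausible_eq_zero`).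

The test can depend on `ν` and still be prequential because the forecasts along a single realization
determine an exchangeable theory completely (`reconstructedProfile_eq`). -/

/-! ### Cylinders and permutation invariance -/

theorem mem_cyl_iff {n : ℕ} {σ : Fin n → Fin 2} {x : Realization} :
    x ∈ cyl σ ↔ initialSegment x n = σ :=
  ⟨fun h => funext h, fun h i => congrFun h i⟩

theorem continuous_initialSegment (n : ℕ) : Continuous fun x => initialSegment x n :=
  continuous_pi fun i => continuous_apply (i : ℕ)

theorem isClopen_setOf_initialSegment_mem {n : ℕ} (S : Set (Fin n → Fin 2)) :
    IsClopen {x | initialSegment x n ∈ S} :=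
  (isClopen_discrete S).preimage (continuous_initialSegment n)

theorem isClopen_cyl {n : ℕ} (σ : Fin n → Fin 2) : IsClopen (cyl σ) := by
  have h : cyl σ = {x | initialSegment x n ∈ ({σ} : Set (Fin n → Fin 2))} := by
    ext x; exact mem_cyl_iff
  rw [h]
  exact isClopen_setOf_initialSegment_mem _

theorem measurableSet_cyl {n : ℕ} (σ : Fin n → Fin 2) : MeasurableSet (cyl σ) :=
  (isClopen_cyl σ).isOpen.measurableSet

/-- The probability of an event about the first `n` outcomes is a sum over cylinders. -/
theorem measure_setOf_initialSegment (μ : Measure Realization) {n : ℕ}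
    (p : (Fin n → Fin 2) → Prop) [DecidablePred p] :
    μ {x | p (initialSegment x n)} = ∑ σ with p σ, μ (cyl σ) := by
  rw [← measure_biUnion_finset]
  · congr 1
    ext x
    simp [mem_cyl_iff]
  · intro σ _ τ _ hne
    refine Set.disjoint_left.2 fun x hx hx' => hne ?_
    rw [← mem_cyl_iff.1 hx, mem_cyl_iff.1 hx']
  · exact fun σ _ => measurableSet_cyl σ

theorem sum_measure_cyl (μ : Theory) (n : ℕ) :
    ∑ σ : Fin n → Fin 2, (μ : Measure Realization) (cyl σ) = 1 := by
  have h := measure_setOf_initialSegment (μ : Measure Realization) (n := n) fun _ => True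
  simpa using h.symm

/-- An injection into `{0, …, N - 1}` extends to a permutation of that set. Both events are unions
of cylinders of length `N`, and the permutation matches these cylinders. -/
theorem measure_setOf_eq_comp_injective {μ : Theory} (hμ : μ ∈ exchangeable) {n : ℕ}
    (σ : Fin n → Fin 2) {f : Fin n → ℕ} (hf : Function.Injective f) :
    (μ : Measure Realization) {x | ∀ i, x (f i) = σ i} = (μ : Measure Realization) (cyl σ) := by
  obtain ⟨N, hnN, hfN⟩ : ∃ N, n ≤ N ∧ ∀ i, f i < N := by
    refine ⟨n + ∑ i, f i + 1, by omega, fun i => ?_⟩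
    have := Finset.single_le_sum (f := f) (fun _ _ => Nat.zero_le _) (Finset.mem_univ i)
    omega
  let g : Fin n → Fin N := fun i => ⟨f i, hfN i⟩
  obtain ⟨P, hP⟩ := Equiv.Perm.exists_extending_pair (Fin.castLE hnN) g
    (Fin.castLE_injective hnN) (fun i j h => hf (by simpa [g] using h))
  have h1 := measure_setOf_initialSegment (μ : Measure Realization) (n := N)
    fun τ => ∀ i, τ (g i) = σ i
  have h2 := measure_setOf_initialSegment (μ : Measure Realization) (n := N)
    fun τ => ∀ i, τ (Fin.castLE hnN i) = σ i
  change (μ : Measure Realization) {x | ∀ i, x (f i) = σ i} = _ at h1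
  change (μ : Measure Realization) (cyl σ) = _ at h2
  rw [h1, h2]
  refine Finset.sum_equiv (P.arrowCongr (Equiv.refl _)).symm (fun τ => ?_) fun τ _ => hμ N τ P
  simp [hP]

theorem measure_cyl_eq_of_card_eq {μ : Theory} (hμ : μ ∈ exchangeable) {n : ℕ}
    {σ τ : Fin n → Fin 2}
    (h : (Finset.univ.filter fun i => σ i = 1).card = (Finset.univ.filter fun i => τ i = 1).card) :
    (μ : Measure Realization) (cyl σ) = (μ : Measure Realization) (cyl τ) := by
  obtain ⟨P, hP⟩ := Equiv.Perm.exists_map_finset_eq _ _ h.symm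
  rw [hμ n σ P]
  congr 2
  funext i
  have hi : σ (P i) = 1 ↔ τ i = 1 := by
    have h1 : P i ∈ Finset.univ.filter (fun i => σ i = 1) ↔
        i ∈ Finset.univ.filter (fun i => τ i = 1) := by
      rw [← hP]
      exact Finset.mem_map' P.toEmbedding
    simpa using h1
  generalize σ (P i) = a at hi ⊢
  generalize τ i = b at hi ⊢
  revert a b
  decide

/-! ### Second moments of exchangeable outcomes -/

/-- The outcome of period `i` as a real number. -/
noncomputable def outcome (i : ℕ) (x : Realization) : ℝ := ((x i : ℕ) : ℝ)

theorem continuous_outcome (i : ℕ) : Continuous (outcome i) :=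
  (continuous_of_discreteTopology (f := fun s : Fin 2 => ((s : ℕ) : ℝ))).comp (continuous_apply i)

theorem outcome_mul_outcome (i j : ℕ) (x : Realization) :
    outcome i x * outcome j x = Set.indicator {x | x i = 1 ∧ x j = 1} (fun _ => (1 : ℝ)) x := by
  unfold outcome
  simp only [Set.indicator_apply, Set.mem_ofPred_eq]
  have hs : ∀ s : Fin 2, s = 0 ∨ s = 1 := by decide
  rcases hs (x i) with hi | hi <;> rcases hs (x j) with hj | hj <;> simp [hi, hj]

theorem measurableSet_setOf_eq_and_eq (i j : ℕ) :
    MeasurableSet {x : Realization | x i = 1 ∧ x j = 1} :=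
  (measurableSet_eq_fun (measurable_pi_apply i) measurable_const).inter
    (measurableSet_eq_fun (measurable_pi_apply j) measurable_const)

theorem integral_outcome_mul_outcome (μ : Measure Realization) (i j : ℕ) :
    ∫ x, outcome i x * outcome j x ∂μ = μ.real {x | x i = 1 ∧ x j = 1} := by
  simp_rw [outcome_mul_outcome]
  exact integral_indicator_one (measurableSet_setOf_eq_and_eq i j)

theorem integrable_outcome_mul_outcome (μ : Measure Realization) [IsFiniteMeasure μ] (i j : ℕ) :
    Integrable (fun x => outcome i x * outcome j x) μ := by
  simp_rw [outcome_mul_outcome]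
  exact (integrable_const _).indicator (measurableSet_setOf_eq_and_eq i j)

theorem integral_outcome_sq {μ : Theory} (hμ : μ ∈ exchangeable) (i : ℕ) :
    ∫ x, outcome i x * outcome i x ∂(μ : Measure Realization) =
      (μ : Measure Realization).real (cyl fun _ : Fin 1 => 1) := by
  rw [integral_outcome_mul_outcome, measureReal_def, measureReal_def,
    ← measure_setOf_eq_comp_injective hμ (fun _ : Fin 1 => 1) (f := fun _ => i)
      (Function.injective_of_subsingleton _)]
  simp

theorem integral_outcome_mul_outcome_of_ne {μ : Theory} (hμ : μ ∈ exchangeable) {i j : ℕ}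
    (hij : i ≠ j) :
    ∫ x, outcome i x * outcome j x ∂(μ : Measure Realization) =
      (μ : Measure Realization).real (cyl fun _ : Fin 2 => 1) := by
  rw [integral_outcome_mul_outcome, measureReal_def, measureReal_def,
    ← measure_setOf_eq_comp_injective hμ (fun _ : Fin 2 => 1) (f := ![i, j])
      (by intro a b; fin_cases a <;> fin_cases b <;> simp [hij, hij.symm])]
  simp [Fin.forall_fin_two]

theorem integrable_sum_outcome_sq (μ : Measure Realization) [IsFiniteMeasure μ] (s : Finset ℕ)
    (c : ℕ → ℝ) : Integrable (fun x => (∑ i ∈ s, c i * outcome i x) ^ 2) μ := by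
  simp_rw [sq, Finset.sum_mul_sum, mul_mul_mul_comm]
  exact integrable_finsetSum _ fun i _ => integrable_finsetSum _ fun j _ =>
    (integrable_outcome_mul_outcome μ i j).const_mul _

/-- The second moment of a linear combination of exchangeable outcomes. -/
theorem integral_sum_outcome_sq {μ : Theory} (hμ : μ ∈ exchangeable) (s : Finset ℕ)
    (c : ℕ → ℝ) :
    ∫ x, (∑ i ∈ s, c i * outcome i x) ^ 2 ∂(μ : Measure Realization) =
      ((μ : Measure Realization).real (cyl fun _ : Fin 1 => 1) -
          (μ : Measure Realization).real (cyl fun _ : Fin 2 => 1)) * ∑ i ∈ s, c i ^ 2 +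
        (μ : Measure Realization).real (cyl fun _ : Fin 2 => 1) * (∑ i ∈ s, c i) ^ 2 := by
  set a := (μ : Measure Realization).real (cyl fun _ : Fin 1 => 1)
  set b := (μ : Measure Realization).real (cyl fun _ : Fin 2 => 1)
  -- Exchangeability leaves only two mixed moments: `a` on the diagonal and `b` off it.
  have hterm : ∀ i j, ∫ x, outcome i x * outcome j x ∂(μ : Measure Realization) =
      b + if i = j then a - b else 0 := by
    intro i j
    split_ifs with h
    · subst h
      rw [integral_outcome_sq hμ]
      ring
    · rw [integral_outcome_mul_outcome_of_ne hμ h, add_zero]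
  simp_rw [sq, Finset.sum_mul_sum, mul_mul_mul_comm]
  rw [integral_finsetSum _ fun i _ => integrable_finsetSum _ fun j _ =>
    (integrable_outcome_mul_outcome _ i j).const_mul _]
  have h1 : ∀ i ∈ s, ∫ x, ∑ j ∈ s, c i * c j * (outcome i x * outcome j x)
      ∂(μ : Measure Realization) = b * ∑ j ∈ s, c i * c j + (a - b) * (c i * c i) := by
    intro i hi
    rw [integral_finsetSum _ fun j _ => (integrable_outcome_mul_outcome _ i j).const_mul _]
    simp_rw [integral_const_mul, hterm, mul_add, Finset.sum_add_distrib, mul_ite, mul_zero]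
    rw [Finset.sum_ite_eq, if_pos hi, ← Finset.sum_mul]
    ring
  rw [Finset.sum_congr rfl h1, Finset.sum_add_distrib, ← Finset.mul_sum, ← Finset.mul_sum]
  ring

/-- Chebyshev's inequality. -/
theorem mul_measure_le_abs_sum_outcome (μ : Measure Realization) [IsFiniteMeasure μ]
    (s : Finset ℕ) (c : ℕ → ℝ) {ε : ℝ} (hε : 0 ≤ ε) :
    ε ^ 2 * μ.real {x | ε ≤ |∑ i ∈ s, c i * outcome i x|} ≤
      ∫ x, (∑ i ∈ s, c i * outcome i x) ^ 2 ∂μ := by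
  have h := mul_meas_ge_le_integral_of_nonneg (μ := μ)
    (ae_of_all _ fun x => sq_nonneg (∑ i ∈ s, c i * outcome i x))
    (integrable_sum_outcome_sq μ s c) (ε ^ 2)
  have hset : {x | ε ≤ |∑ i ∈ s, c i * outcome i x|} =
      {x | ε ^ 2 ≤ (∑ i ∈ s, c i * outcome i x) ^ 2} := by
    ext x
    simp only [Set.mem_ofPred_eq]
    rw [sq_le_sq, abs_of_nonneg hε]
  rwa [hset]

/-! ### Empirical frequencies and their limit -/

/-- The frequency of the outcome `1` in the first `n` periods. -/
noncomputable def frequency (n : ℕ) (x : Realization) : ℝ :=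
  ∑ i ∈ Finset.range n, (n : ℝ)⁻¹ * outcome i x

theorem continuous_frequency (n : ℕ) : Continuous (frequency n) :=
  continuous_finsetSum _ fun i _ => continuous_const.mul (continuous_outcome i)

theorem frequency_eq_sum_fin (n : ℕ) (x : Realization) :
    frequency n x = ∑ i : Fin n, (n : ℝ)⁻¹ * ((initialSegment x n i : ℕ) : ℝ) :=
  Finset.sum_range _

theorem isClopen_frequency_mem (n : ℕ) (V : Set ℝ) : IsClopen {x | frequency n x ∈ V} := by
  simp_rw [frequency_eq_sum_fin]
  exact isClopen_setOf_initialSegment_mem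
    {σ : Fin n → Fin 2 | ∑ i : Fin n, (n : ℝ)⁻¹ * ((σ i : ℕ) : ℝ) ∈ V}

theorem outcome_nonneg (i : ℕ) (x : Realization) : 0 ≤ outcome i x := Nat.cast_nonneg _

theorem outcome_le_one (i : ℕ) (x : Realization) : outcome i x ≤ 1 := by
  unfold outcome
  exact_mod_cast Nat.lt_succ_iff.1 (x i).2

theorem frequency_nonneg (n : ℕ) (x : Realization) : 0 ≤ frequency n x :=
  Finset.sum_nonneg fun i _ => mul_nonneg (by positivity) (outcome_nonneg i x)

theorem frequency_le_one (n : ℕ) (x : Realization) : frequency n x ≤ 1 := by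
  calc frequency n x ≤ ∑ _i ∈ Finset.range n, (n : ℝ)⁻¹ :=
        Finset.sum_le_sum fun i _ => mul_le_of_le_one_right (by positivity) (outcome_le_one i x)
    _ = n * (n : ℝ)⁻¹ := by simp
    _ ≤ 1 := mul_inv_le_one

theorem moment_gap_nonneg (μ : Theory) :
    0 ≤ (μ : Measure Realization).real (cyl fun _ : Fin 1 => 1) -
      (μ : Measure Realization).real (cyl fun _ : Fin 2 => 1) :=
  sub_nonneg.2 <| measureReal_mono fun x hx i => by
    have := hx 0
    fin_cases i
    simpa using this

theorem moment_gap_le_one (μ : Theory) :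
    (μ : Measure Realization).real (cyl fun _ : Fin 1 => 1) -
      (μ : Measure Realization).real (cyl fun _ : Fin 2 => 1) ≤ 1 :=
  (sub_le_self _ measureReal_nonneg).trans measureReal_le_one

theorem frequency_sub_frequency {n m : ℕ} (h : n ≤ m) (x : Realization) :
    frequency m x - frequency n x =
      ∑ i ∈ Finset.range m, ((m : ℝ)⁻¹ - if i < n then (n : ℝ)⁻¹ else 0) * outcome i x := by
  simp_rw [sub_mul, Finset.sum_sub_distrib, ite_mul, zero_mul]
  congr 1
  rw [← Finset.sum_filter, frequency]
  congr 1
  ext i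
  simp only [Finset.mem_range, Finset.mem_filter]
  omega

/-- The weights of the difference sum to zero, so the common mixed moment drops out and only the
moment gap times `1 / n - 1 / m` remains. -/
theorem integral_frequency_sub_sq_le {μ : Theory} (hμ : μ ∈ exchangeable) {n m : ℕ} (hn : 0 < n)
    (h : n ≤ m) :
    ∫ x, (frequency m x - frequency n x) ^ 2 ∂(μ : Measure Realization) ≤ (n : ℝ)⁻¹ := by
  simp_rw [frequency_sub_frequency h]
  have hfilter : (Finset.range m).filter (· < n) = Finset.range n := by
    ext i
    simp only [Finset.mem_range, Finset.mem_filter]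
    omega
  have hn' : (n : ℝ) ≠ 0 := by positivity
  have hm' : (m : ℝ) ≠ 0 := by
    have : 0 < m := by omega
    positivity
  have h1 : ∑ i ∈ Finset.range m, ((m : ℝ)⁻¹ - if i < n then (n : ℝ)⁻¹ else 0) = 0 := by
    rw [Finset.sum_sub_distrib, ← Finset.sum_filter, hfilter]
    simp [hn', hm']
  have h2 : ∑ i ∈ Finset.range m, ((m : ℝ)⁻¹ - if i < n then (n : ℝ)⁻¹ else 0) ^ 2 =
      (n : ℝ)⁻¹ - (m : ℝ)⁻¹ := by
    have : ∀ i, ((m : ℝ)⁻¹ - if i < n then (n : ℝ)⁻¹ else 0) ^ 2 =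
        (m : ℝ)⁻¹ ^ 2 + if i < n then (n : ℝ)⁻¹ ^ 2 - 2 * (m : ℝ)⁻¹ * (n : ℝ)⁻¹ else 0 := by
      intro i
      split_ifs <;> ring
    simp_rw [this]
    rw [Finset.sum_add_distrib, ← Finset.sum_filter, hfilter]
    simp only [Finset.sum_const, Finset.card_range, nsmul_eq_mul]
    field_simp
    ring
  rw [integral_sum_outcome_sq hμ, h1, h2]
  have h3 : (n : ℝ)⁻¹ - (m : ℝ)⁻¹ ≤ (n : ℝ)⁻¹ := sub_le_self _ (by positivity)
  have h4 : (0 : ℝ) ≤ (n : ℝ)⁻¹ - (m : ℝ)⁻¹ :=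
    sub_nonneg.2 (inv_anti₀ (by positivity) (by exact_mod_cast h))
  nlinarith [moment_gap_nonneg μ, moment_gap_le_one μ]

/-- Chebyshev divides the second moment `8⁻ᵏ` by `4⁻ᵏ`. Along the periods `8 ^ k` both the
deviations and their probabilities are thus summable. -/
theorem measure_le_abs_frequency_sub_le {μ : Theory} (hμ : μ ∈ exchangeable) (k : ℕ) :
    (μ : Measure Realization)
        {x | (1 / 2 : ℝ) ^ k ≤ |frequency (8 ^ (k + 1)) x - frequency (8 ^ k) x|} ≤
      (2⁻¹ : ENNReal) ^ k := by
  have hle : 8 ^ k ≤ 8 ^ (k + 1) := Nat.pow_le_pow_right (by norm_num) (Nat.le_succ k)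
  have h1 := integral_frequency_sub_sq_le hμ (pow_pos (by norm_num) k) hle
  simp_rw [frequency_sub_frequency hle] at h1 ⊢
  have h3 : ((8 ^ k : ℕ) : ℝ)⁻¹ = ((1 / 2 : ℝ) ^ k) ^ 2 * (1 / 2) ^ k := by
    push_cast
    rw [← inv_pow, ← pow_mul, mul_comm k 2, pow_mul, ← mul_pow]
    norm_num
  have h2 := (mul_measure_le_abs_sum_outcome (μ : Measure Realization) _ _
    (by positivity : (0 : ℝ) ≤ (1 / 2) ^ k)).trans (h1.trans_eq h3)
  have h4 := le_of_mul_le_mul_left h2 (by positivity)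
  have h5 : (2⁻¹ : ENNReal) ^ k = ENNReal.ofReal ((1 / 2) ^ k) := by
    rw [ENNReal.ofReal_pow (by norm_num), one_div, ENNReal.ofReal_inv_of_pos (by norm_num)]
    norm_num
  rw [h5]
  exact (ENNReal.le_ofReal_iff_toReal_le (measure_ne_top _ _) (by positivity)).2 h4

/-- The limiting frequency of the outcome `1` along the periods `8 ^ k`. -/
noncomputable def limitFrequency (x : Realization) : ℝ :=
  limsup (fun k => frequency (8 ^ k) x) atTop

theorem measurable_limitFrequency : Measurable limitFrequency :=
  Measurable.limsup fun k => (continuous_frequency (8 ^ k)).measurable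

/-- The bound is the exact geometric partial sum, which lets the induction close. -/
theorem abs_frequency_sub_le {x : Realization} {K : ℕ}
    (h : ∀ m, |frequency (8 ^ (K + m + 1)) x - frequency (8 ^ (K + m)) x| < (1 / 2 : ℝ) ^ (K + m))
    (m : ℕ) : |frequency (8 ^ (K + m)) x - frequency (8 ^ K) x| ≤
      2 * (1 / 2 : ℝ) ^ K - 2 * (1 / 2 : ℝ) ^ (K + m) := by
  induction m with
  | zero => simp
  | succ m ih =>
    have h1 := abs_sub_le (frequency (8 ^ (K + (m + 1))) x) (frequency (8 ^ (K + m)) x)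
      (frequency (8 ^ K) x)
    have h2 := h m
    rw [add_assoc] at h2
    have h3 : (1 / 2 : ℝ) ^ (K + (m + 1)) = (1 / 2) ^ (K + m) * (1 / 2) := by
      rw [← add_assoc, pow_succ]
    rw [h3]
    linarith

theorem abs_limitFrequency_sub_le {x : Realization} {K : ℕ}
    (h : ∀ m, |frequency (8 ^ (K + m + 1)) x - frequency (8 ^ (K + m)) x| <
      (1 / 2 : ℝ) ^ (K + m)) :
    |limitFrequency x - frequency (8 ^ K) x| ≤ 2 * (1 / 2 : ℝ) ^ K := by
  have hev : ∀ k ≥ K, |frequency (8 ^ k) x - frequency (8 ^ K) x| ≤ 2 * (1 / 2 : ℝ) ^ K := by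
    intro k hk
    obtain ⟨m, rfl⟩ := Nat.exists_eq_add_of_le hk
    refine (abs_frequency_sub_le h m).trans (sub_le_self _ (by positivity))
  have hbdd : IsBoundedUnder (· ≤ ·) atTop fun k => frequency (8 ^ k) x :=
    isBoundedUnder_of ⟨1, fun k => frequency_le_one _ x⟩
  have hcobdd : IsCoboundedUnder (· ≤ ·) atTop fun k => frequency (8 ^ k) x :=
    (isBoundedUnder_of ⟨0, fun k => frequency_nonneg _ x⟩ :
      IsBoundedUnder (· ≥ ·) atTop fun k => frequency (8 ^ k) x).isCoboundedUnder_le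
  rw [abs_le, neg_le_sub_iff_le_add, sub_le_iff_le_add]
  constructor
  · rw [← sub_le_iff_le_add]
    refine le_limsup_of_frequently_le (Eventually.frequently ?_) hbdd
    filter_upwards [eventually_ge_atTop K] with k hk
    have := (abs_le.1 (hev k hk)).1
    linarith
  · refine limsup_le_of_le hcobdd ?_
    filter_upwards [eventually_ge_atTop K] with k hk
    have := (abs_le.1 (hev k hk)).2
    linarith

/-- The points at distance at most `2 * (1 / 2) ^ K` from some point of `F`. -/
def fattening (F : Set ℝ) (K : ℕ) : Set ℝ :=
  {t | ∃ y ∈ F, |y - t| ≤ 2 * (1 / 2 : ℝ) ^ K}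

/-- Replaces a tail event by one about the first `8 ^ K` outcomes, with an error uniform over
exchangeable theories: the union bound over all later deviations costs `2 * 2⁻¹ ^ K`. -/
theorem measure_limitFrequency_mem_le {μ : Theory} (hμ : μ ∈ exchangeable) (F : Set ℝ) (K : ℕ) :
    (μ : Measure Realization) {x | limitFrequency x ∈ F} ≤
      (μ : Measure Realization) {x | frequency (8 ^ K) x ∈ fattening F K} +
        (2⁻¹ : ENNReal) ^ K * 2 := by
  have hsub : {x | limitFrequency x ∈ F} ⊆ {x | frequency (8 ^ K) x ∈ fattening F K} ∪
      ⋃ m, {x | (1 / 2 : ℝ) ^ (K + m) ≤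
        |frequency (8 ^ (K + m + 1)) x - frequency (8 ^ (K + m)) x|} := by
    intro x hx
    by_cases h : ∀ m, |frequency (8 ^ (K + m + 1)) x - frequency (8 ^ (K + m)) x| <
      (1 / 2 : ℝ) ^ (K + m)
    · exact Or.inl ⟨_, hx, abs_limitFrequency_sub_le h⟩
    · push Not at h
      exact Or.inr (Set.mem_iUnion.2 h)
  refine (measure_mono hsub).trans ((measure_union_le _ _).trans (add_le_add le_rfl ?_))
  refine (measure_iUnion_le _).trans ((ENNReal.tsum_le_tsum fun m =>
    measure_le_abs_frequency_sub_le hμ (K + m)).trans_eq ?_)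
  simp_rw [pow_add]
  rw [ENNReal.tsum_mul_left, ENNReal.tsum_geometric, ENNReal.one_sub_inv_two, inv_inv]

/-! ### Independent coin tosses -/

/-- The law of a coin that shows `1` with probability `t`. -/
noncomputable def coin (t : unitInterval) : Measure (Fin 2) :=
  ENNReal.ofReal t • Measure.dirac 1 + ENNReal.ofReal (1 - t) • Measure.dirac 0

instance (t : unitInterval) : IsProbabilityMeasure (coin t) := by
  constructor
  simp [coin, ← ENNReal.ofReal_add t.2.1 (sub_nonneg.2 t.2.2)]

/-- The probability of the outcome `s` for a coin that shows `1` with probability `t`. -/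
def coinWeight (t : ℝ) (s : Fin 2) : ℝ := if s = 1 then t else 1 - t

theorem coinWeight_nonneg (t : unitInterval) (s : Fin 2) : 0 ≤ coinWeight t s := by
  unfold coinWeight
  split_ifs
  exacts [t.2.1, sub_nonneg.2 t.2.2]

theorem coin_singleton (t : unitInterval) (s : Fin 2) :
    coin t {s} = ENNReal.ofReal (coinWeight t s) := by
  fin_cases s <;> simp [coin, coinWeight]

/-- The theory of independent tosses of a coin that shows `1` with probability `t`. -/
noncomputable def iid (t : unitInterval) : Theory :=
  ⟨Measure.infinitePi fun _ => coin t, inferInstance⟩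

theorem iid_cyl (t : unitInterval) {n : ℕ} (σ : Fin n → Fin 2) :
    (iid t : Measure Realization) (cyl σ) = ENNReal.ofReal (∏ i, coinWeight t (σ i)) := by
  have hset : cyl σ = Set.pi (Finset.range n)
      fun i => if h : i < n then {σ ⟨i, h⟩} else Set.univ := by
    ext x
    simp only [cyl, Set.mem_ofPred_eq, Set.mem_pi, Finset.coe_range, Set.mem_Iio]
    constructor
    · intro h i hi
      simpa [hi] using h ⟨i, hi⟩
    · intro h i
      simpa using h i i.2
  rw [hset]
  change Measure.infinitePi (fun _ => coin t) _ = _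
  rw [Measure.infinitePi_pi _ fun i _ => by measurability,
    ENNReal.ofReal_prod_of_nonneg fun i _ => coinWeight_nonneg t _, Finset.prod_range]
  simp [coin_singleton]

theorem iid_mem_exchangeable (t : unitInterval) : iid t ∈ exchangeable := by
  intro n σ π
  rw [iid_cyl, iid_cyl, Equiv.prod_comp π fun i => coinWeight t (σ i)]

theorem integral_outcome_iid (t : unitInterval) (i : ℕ) :
    ∫ x, outcome i x ∂(iid t : Measure Realization) = t := by
  have h := integral_outcome_sq (iid_mem_exchangeable t) i
  have h1 : ∀ x, outcome i x * outcome i x = outcome i x := by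
    intro x
    have hs : ∀ s : Fin 2, s = 0 ∨ s = 1 := by decide
    unfold outcome
    rcases hs (x i) with hi | hi <;> simp [hi]
  simp_rw [h1] at h
  rw [h, measureReal_def, iid_cyl]
  simp [coinWeight, t.2.1]

theorem integrable_outcome (μ : Measure Realization) [IsFiniteMeasure μ] (i : ℕ) :
    Integrable (outcome i) μ :=
  Integrable.of_bound (continuous_outcome i).aestronglyMeasurable 1 <| ae_of_all _ fun x => by
    rw [Real.norm_of_nonneg (outcome_nonneg i x)]
    exact outcome_le_one i x

theorem integrable_frequency (μ : Measure Realization) [IsFiniteMeasure μ] (n : ℕ) :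
    Integrable (frequency n) μ :=
  integrable_finsetSum _ fun i _ => (integrable_outcome μ i).const_mul _

theorem integral_frequency_iid (t : unitInterval) {n : ℕ} (hn : 0 < n) :
    ∫ x, frequency n x ∂(iid t : Measure Realization) = t := by
  unfold frequency
  rw [integral_finsetSum _ fun i _ => (integrable_outcome _ i).const_mul _]
  simp_rw [integral_const_mul, integral_outcome_iid]
  simp [hn.ne']

/-- The general second-moment formula with gap `t - t ^ 2` gives the variance `t * (1 - t) / n`. -/
theorem integral_frequency_sub_sq_iid (t : unitInterval) {n : ℕ} (hn : 0 < n) :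
    ∫ x, (frequency n x - t) ^ 2 ∂(iid t : Measure Realization) ≤ (n : ℝ)⁻¹ := by
  have hsq := integrable_sum_outcome_sq (iid t : Measure Realization) (Finset.range n)
    fun _ => (n : ℝ)⁻¹
  have h := integral_sum_outcome_sq (iid_mem_exchangeable t) (Finset.range n) fun _ => (n : ℝ)⁻¹
  change Integrable (fun x => frequency n x ^ 2) _ at hsq
  change ∫ x, frequency n x ^ 2 ∂_ = _ at h
  have hn' : (n : ℝ) ≠ 0 := by positivity
  simp only [measureReal_def, iid_cyl] at h
  simp only [coinWeight, Finset.prod_const, Finset.card_univ, Fintype.card_fin, if_true,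
    Finset.sum_const, Finset.card_range, nsmul_eq_mul, mul_inv_cancel₀ hn'] at h
  rw [ENNReal.toReal_ofReal (by simpa using t.2.1), ENNReal.toReal_ofReal (by positivity)] at h
  have hexp : ∀ x, (frequency n x - t) ^ 2 =
      frequency n x ^ 2 - 2 * (t : ℝ) * frequency n x + (t : ℝ) ^ 2 := fun x => by ring
  simp_rw [hexp]
  have hlin : Integrable (fun x => frequency n x ^ 2 - 2 * (t : ℝ) * frequency n x)
      (iid t : Measure Realization) := hsq.sub ((integrable_frequency _ n).const_mul _)
  rw [integral_add hlin (integrable_const _),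
    integral_sub hsq ((integrable_frequency _ n).const_mul _), integral_const_mul,
    integral_frequency_iid t hn, h]
  have h1 : (n : ℝ) * (n : ℝ)⁻¹ ^ 2 = (n : ℝ)⁻¹ := by field_simp
  rw [h1]
  have h2 := t.2.1
  have h3 := t.2.2
  have h4 : (0 : ℝ) ≤ (n : ℝ)⁻¹ := by positivity
  have h5 : (t : ℝ) ^ 1 - (t : ℝ) ^ 2 ≤ 1 := by nlinarith
  simp only [integral_const, probReal_univ, smul_eq_mul, one_mul, one_pow, mul_one]
  nlinarith

theorem mul_measureReal_le_abs_frequency_sub_iid (t : unitInterval) {n : ℕ} (hn : 0 < n) (ε : ℝ)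
    (hε : 0 ≤ ε) :
    ε ^ 2 * (iid t : Measure Realization).real {x | ε ≤ |frequency n x - t|} ≤ (n : ℝ)⁻¹ := by
  have hint : Integrable (fun x => (frequency n x - t) ^ 2) (iid t : Measure Realization) := by
    refine Integrable.of_bound
      (((continuous_frequency n).sub continuous_const).pow 2).aestronglyMeasurable 1 <|
      ae_of_all _ fun x => ?_
    rw [Real.norm_of_nonneg (sq_nonneg _), sq_le_one_iff_abs_le_one, abs_le]
    have := frequency_nonneg n x
    have := frequency_le_one n x
    have := t.2.1
    have := t.2.2
    constructor <;> linarith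
  have h := mul_meas_ge_le_integral_of_nonneg (ae_of_all _ fun x => sq_nonneg _) hint (ε ^ 2)
  have hset : {x | ε ≤ |frequency n x - t|} = {x | ε ^ 2 ≤ (frequency n x - t) ^ 2} := by
    ext x
    simp only [Set.mem_ofPred_eq]
    rw [sq_le_sq, abs_of_nonneg hε]
  rw [hset]
  exact h.trans (integral_frequency_sub_sq_iid t hn)

/-- Independent tosses of a coin whose bias avoids a closed set have frequencies that stay away
from that set. -/
theorem tendsto_iid_frequency_mem_fattening {F : Set ℝ} (hF : IsClosed F) {t : unitInterval}
    (ht : (t : ℝ) ∉ F) :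
    Tendsto (fun K => (iid t : Measure Realization) {x | frequency (8 ^ K) x ∈ fattening F K})
      atTop (𝓝 0) := by
  obtain ⟨d, hd, hball⟩ := Metric.isOpen_iff.1 hF.isOpen_compl (t : ℝ) ht
  have hd2 : 0 < d / 2 := by positivity
  -- Once the fattening radius is below half the distance `d`, a frequency in the fattening is at
  -- least `d / 2` away from `t`, which Chebyshev makes unlikely.
  have hsmall : ∀ᶠ K : ℕ in atTop, 2 * (1 / 2 : ℝ) ^ K < d / 2 := by
    have h := (tendsto_pow_atTop_nhds_zero_of_lt_one (r := (1 / 2 : ℝ)) (by norm_num)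
      (by norm_num)).const_mul 2
    rw [mul_zero] at h
    exact h.eventually_lt_const hd2
  have hlim : Tendsto (fun K : ℕ => ENNReal.ofReal (((d / 2) ^ 2)⁻¹ * (1 / 8 : ℝ) ^ K)) atTop
      (𝓝 0) := by
    have h := (tendsto_pow_atTop_nhds_zero_of_lt_one (r := (1 / 8 : ℝ)) (by norm_num)
      (by norm_num)).const_mul ((d / 2) ^ 2)⁻¹
    simpa using ENNReal.tendsto_ofReal h
  refine tendsto_of_tendsto_of_tendsto_of_le_of_le' tendsto_const_nhds hlim
    (Eventually.of_forall fun _ => zero_le) ?_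
  filter_upwards [hsmall] with K hK
  have hsub : {x | frequency (8 ^ K) x ∈ fattening F K} ⊆
      {x | d / 2 ≤ |frequency (8 ^ K) x - t|} := by
    rintro x ⟨y, hy, hyx⟩
    have h1 : d ≤ |y - t| := by
      by_contra hlt
      exact hball (by simpa [Real.dist_eq] using hlt) hy
    have h2 := abs_sub_le y (frequency (8 ^ K) x) t
    simp only [Set.mem_ofPred_eq]
    linarith
  refine (measure_mono hsub).trans ((ENNReal.le_ofReal_iff_toReal_le (measure_ne_top _ _)
    (by positivity)).2 ?_)
  have h := mul_measureReal_le_abs_frequency_sub_iid t (n := 8 ^ K) (by positivity) (d / 2) hd2.le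
  change (iid t : Measure Realization).real _ ≤ _
  rw [← div_eq_inv_mul, le_div_iff₀ (by positivity), mul_comm]
  refine h.trans_eq ?_
  push_cast
  rw [one_div, inv_pow]

/-! ### Approximation by finite mixtures of coins -/

/-- The theory that draws an initial segment of length `N` according to `μ`, and then tosses a coin
whose bias depends on that segment. -/
noncomputable def coinMixture (μ : Theory) {N : ℕ} (τ : (Fin N → Fin 2) → unitInterval) : Theory :=
  ⟨∑ σ, (μ : Measure Realization) (cyl σ) • (iid (τ σ) : Measure Realization), by
    constructor
    simp [sum_measure_cyl]⟩

theorem coinMixture_apply (μ : Theory) {N : ℕ} (τ : (Fin N → Fin 2) → unitInterval)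
    (s : Set Realization) :
    (coinMixture μ τ : Measure Realization) s =
      ∑ σ, (μ : Measure Realization) (cyl σ) * (iid (τ σ) : Measure Realization) s := by
  change (∑ σ, (μ : Measure Realization) (cyl σ) • (iid (τ σ) : Measure Realization)) s = _
  simp

/-- The drawn segment only selects the bias and is not part of the realization, so every component
is exchangeable. -/
theorem coinMixture_mem_exchangeable (μ : Theory) {N : ℕ} (τ : (Fin N → Fin 2) → unitInterval) :
    coinMixture μ τ ∈ exchangeable := by
  intro n σ π
  rw [coinMixture_apply, coinMixture_apply]
  exact Finset.sum_congr rfl fun η _ => by rw [iid_mem_exchangeable (τ η) n σ π]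

theorem measureReal_coinMixture_cyl (μ : Theory) {N n : ℕ} (τ : (Fin N → Fin 2) → unitInterval)
    (η : Fin n → Fin 2) :
    (coinMixture μ τ : Measure Realization).real (cyl η) =
      ∑ σ, (μ : Measure Realization).real (cyl σ) * ∏ i, coinWeight (τ σ) (η i) := by
  rw [measureReal_def, coinMixture_apply,
    ENNReal.toReal_sum fun σ _ => ENNReal.mul_ne_top (measure_ne_top _ _) (measure_ne_top _ _)]
  refine Finset.sum_congr rfl fun σ _ => ?_
  rw [ENNReal.toReal_mul, iid_cyl,
    ENNReal.toReal_ofReal (Finset.prod_nonneg fun i _ => coinWeight_nonneg _ _), measureReal_def]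

theorem sum_measureReal_cyl (μ : Theory) (n : ℕ) :
    ∑ σ : Fin n → Fin 2, (μ : Measure Realization).real (cyl σ) = 1 := by
  have h := congrArg ENNReal.toReal (sum_measure_cyl μ n)
  rwa [ENNReal.toReal_sum fun σ _ => measure_ne_top _ _] at h

theorem abs_prod_sub_prod_le {ι : Type*} (s : Finset ι) {a b : ι → ℝ} (ha : ∀ i, |a i| ≤ 1)
    (hb : ∀ i, |b i| ≤ 1) : |∏ i ∈ s, a i - ∏ i ∈ s, b i| ≤ ∑ i ∈ s, |a i - b i| := by
  classical
  induction s using Finset.induction_on with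
  | empty => simp
  | insert j s hj ih =>
    rw [Finset.prod_insert hj, Finset.prod_insert hj, Finset.sum_insert hj]
    have h1 : a j * ∏ i ∈ s, a i - b j * ∏ i ∈ s, b i =
        (a j - b j) * ∏ i ∈ s, a i + b j * (∏ i ∈ s, a i - ∏ i ∈ s, b i) := by ring
    rw [h1]
    refine (abs_add_le _ _).trans (add_le_add ?_ ?_)
    · rw [abs_mul, Finset.abs_prod]
      exact mul_le_of_le_one_right (abs_nonneg _)
        (Finset.prod_le_one (fun i _ => abs_nonneg _) fun i _ => ha i)
    · rw [abs_mul]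
      exact (mul_le_of_le_one_left (abs_nonneg _) (hb j)).trans ih

theorem abs_coinWeight_le_one {t : ℝ} (ht : t ∈ Set.Icc (0 : ℝ) 1) (s : Fin 2) :
    |coinWeight t s| ≤ 1 := by
  unfold coinWeight
  obtain ⟨h0, h1⟩ := ht
  split_ifs <;> rw [abs_le] <;> constructor <;> linarith

theorem abs_coinWeight_sub_coinWeight (t u : ℝ) (s : Fin 2) :
    |coinWeight t s - coinWeight u s| = |t - u| := by
  unfold coinWeight
  split_ifs
  · rfl
  · rw [sub_sub_sub_cancel_left, abs_sub_comm]

/-- The frequency of `1` in a finite sequence. -/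
noncomputable def meanOutcome {N : ℕ} (σ : Fin N → Fin 2) : ℝ :=
  ∑ i, (N : ℝ)⁻¹ * ((σ i : ℕ) : ℝ)

theorem meanOutcome_mem_Icc {N : ℕ} (σ : Fin N → Fin 2) : meanOutcome σ ∈ Set.Icc (0 : ℝ) 1 := by
  have hs : ∀ s : Fin 2, ((s : ℕ) : ℝ) ≤ 1 := fun s => by exact_mod_cast Nat.lt_succ_iff.1 s.2
  refine ⟨Finset.sum_nonneg fun i _ => by positivity, ?_⟩
  calc meanOutcome σ ≤ ∑ _i : Fin N, (N : ℝ)⁻¹ :=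
        Finset.sum_le_sum fun i _ => mul_le_of_le_one_right (by positivity) (hs _)
    _ = N * (N : ℝ)⁻¹ := by simp
    _ ≤ 1 := mul_inv_le_one

/-- Tossing a coin with the empirical bias amounts to drawing a uniformly random position of `σ`. -/
theorem coinWeight_meanOutcome {N : ℕ} (hN : 0 < N) (σ : Fin N → Fin 2) (s : Fin 2) :
    coinWeight (meanOutcome σ) s = ∑ j, if σ j = s then (N : ℝ)⁻¹ else 0 := by
  have h2 : ∀ s : Fin 2, s = 0 ∨ s = 1 := by decide
  have hone : ∑ j : Fin N, (N : ℝ)⁻¹ = 1 := by simp [hN.ne']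
  rcases h2 s with rfl | rfl
  · simp only [coinWeight, meanOutcome, zero_ne_one, if_false]
    rw [← hone, ← Finset.sum_sub_distrib]
    refine Finset.sum_congr rfl fun j _ => ?_
    rcases h2 (σ j) with h | h <;> simp [h]
  · simp only [coinWeight, meanOutcome, if_true]
    refine Finset.sum_congr rfl fun j _ => ?_
    rcases h2 (σ j) with h | h <;> simp [h]

/-- Sampling with replacement from the first `N` outcomes, as a sum over samples. -/
theorem sum_measureReal_cyl_mul_prod_coinWeight (μ : Theory) {N n : ℕ} (hN : 0 < N)
    (η : Fin n → Fin 2) :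
    ∑ σ : Fin N → Fin 2, (μ : Measure Realization).real (cyl σ) *
        ∏ i, coinWeight (meanOutcome σ) (η i) =
      ∑ f : Fin n → Fin N, (N : ℝ)⁻¹ ^ n *
        (μ : Measure Realization).real {x | ∀ i, x (f i) = η i} := by
  have hprod : ∀ σ : Fin N → Fin 2, ∏ i, coinWeight (meanOutcome σ) (η i) =
      ∑ f : Fin n → Fin N, if ∀ i, σ (f i) = η i then (N : ℝ)⁻¹ ^ n else 0 := by
    intro σ
    simp_rw [coinWeight_meanOutcome hN]
    -- Expanding the product of sums gives one term for each sample `f` of positions.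
    rw [Finset.prod_univ_sum, Fintype.piFinset_univ]
    refine Finset.sum_congr rfl fun f _ => ?_
    rw [Finset.prod_ite_zero]
    simp
  simp_rw [hprod, Finset.mul_sum]
  rw [Finset.sum_comm]
  refine Finset.sum_congr rfl fun f _ => ?_
  have h := congrArg ENNReal.toReal (measure_setOf_initialSegment (μ : Measure Realization) (n := N)
    fun σ => ∀ i, σ (f i) = η i)
  rw [ENNReal.toReal_sum fun σ _ => measure_ne_top _ _] at h
  change (μ : Measure Realization).real {x | ∀ i, x (f i) = η i} = _ at h
  rw [h, Finset.sum_filter, Finset.mul_sum]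
  refine Finset.sum_congr rfl fun σ _ => ?_
  split_ifs
  · rw [mul_comm]; rfl
  · simp

theorem card_filter_injective (n N : ℕ) :
    (Finset.univ.filter fun f : Fin n → Fin N => Function.Injective f).card =
      N.descFactorial n := by
  rw [← Fintype.card_subtype, Fintype.card_congr (Equiv.subtypeInjectiveEquivEmbedding _ _),
    Fintype.card_embedding_eq, Fintype.card_fin, Fintype.card_fin]

/-- Sampling with replacement from `N` exchangeable outcomes is close to sampling without. -/
theorem abs_sampling_sub_measureReal_cyl_le {μ : Theory} (hμ : μ ∈ exchangeable) {N n : ℕ}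
    (hN : 0 < N) (η : Fin n → Fin 2) :
    |∑ σ : Fin N → Fin 2, (μ : Measure Realization).real (cyl σ) *
        ∏ i, coinWeight (meanOutcome σ) (η i) - (μ : Measure Realization).real (cyl η)| ≤
      1 - (N.descFactorial n : ℝ) / (N : ℝ) ^ n := by
  classical
  have hN' : (N : ℝ) ≠ 0 := by positivity
  have hone : ∑ _f : Fin n → Fin N, (N : ℝ)⁻¹ ^ n = 1 := by
    simp [hN']
  rw [sum_measureReal_cyl_mul_prod_coinWeight μ hN,
    ← one_mul ((μ : Measure Realization).real (cyl η)), ← hone, Finset.sum_mul,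
    ← Finset.sum_sub_distrib]
  refine (Finset.abs_sum_le_sum_abs _ _).trans ?_
  -- Samples without repetition contribute no error, by exchangeability; each other sample costs at
  -- most its weight.
  have hterm : ∀ f : Fin n → Fin N, |(N : ℝ)⁻¹ ^ n *
      (μ : Measure Realization).real {x | ∀ i, x (f i) = η i} -
        (N : ℝ)⁻¹ ^ n * (μ : Measure Realization).real (cyl η)| ≤
      (N : ℝ)⁻¹ ^ n - if Function.Injective f then (N : ℝ)⁻¹ ^ n else 0 := by
    intro f
    split_ifs with hf
    · have h := measure_setOf_eq_comp_injective hμ η (f := fun i => (f i : ℕ))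
        (Fin.val_injective.comp hf)
      rw [measureReal_def, h, measureReal_def]
      simp
    · rw [← mul_sub, abs_mul, abs_of_nonneg (by positivity), sub_zero]
      refine mul_le_of_le_one_right (by positivity) ?_
      have h1 := measureReal_nonneg (μ := (μ : Measure Realization))
        (s := {x | ∀ i, x (f i) = η i})
      have h2 := measureReal_le_one (μ := (μ : Measure Realization))
        (s := {x | ∀ i, x (f i) = η i})
      have h3 := measureReal_nonneg (μ := (μ : Measure Realization)) (s := cyl η)
      have h4 := measureReal_le_one (μ := (μ : Measure Realization)) (s := cyl η)
      rw [abs_le]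
      constructor <;> linarith
  refine (Finset.sum_le_sum fun f _ => hterm f).trans_eq ?_
  rw [Finset.sum_sub_distrib, hone, ← Finset.sum_filter, Finset.sum_const, card_filter_injective,
    nsmul_eq_mul, inv_pow, div_eq_mul_inv]

/-- The cylinders. -/
def cylinders : Set (Set Realization) := {s | ∃ n, ∃ σ : Fin n → Fin 2, cyl σ = s}

/-- Of two cylinders that meet, the longer one is contained in the other. -/
theorem isPiSystem_cylinders : IsPiSystem cylinders := by
  rintro _ ⟨n, σ, rfl⟩ _ ⟨m, η, rfl⟩ ⟨x, hx, hx'⟩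
  rcases le_total n m with h | h
  · refine ⟨m, η, (Set.inter_eq_right.2 fun y hy i => ?_).symm⟩
    have h1 := hx i
    have h2 := hy (Fin.castLE h i)
    have h3 := hx' (Fin.castLE h i)
    simp only [Fin.val_castLE] at h2 h3
    rw [h2, ← h3, h1]
  · refine ⟨n, σ, (Set.inter_eq_left.2 fun y hy i => ?_).symm⟩
    have h1 := hx' i
    have h2 := hy (Fin.castLE h i)
    have h3 := hx (Fin.castLE h i)
    simp only [Fin.val_castLE] at h2 h3
    rw [h2, ← h3, h1]

theorem exists_cyl_subset {u : Set Realization} (hu : IsOpen u) {x : Realization} (hx : x ∈ u) :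
    ∃ n, cyl (initialSegment x n) ⊆ u := by
  obtain ⟨I, v, hv, hvu⟩ := isOpen_pi_iff.1 hu x hx
  refine ⟨I.sup id + 1, fun y hy => hvu fun i hi => ?_⟩
  have hlt : i < I.sup id + 1 := Nat.lt_succ_iff.2 (Finset.le_sup (f := id) hi)
  have h1 : y i = x i := hy ⟨i, hlt⟩
  rw [h1]
  exact (hv i hi).2

/-- Mixtures of coins with biases close to the observed frequencies approximate an exchangeable
theory. -/
theorem tendsto_coinMixture {μ : Theory} (hμ : μ ∈ exchangeable)
    (τ : (N : ℕ) → (Fin N → Fin 2) → unitInterval)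
    (hτ : ∀ N σ, |(τ N σ : ℝ) - meanOutcome σ| ≤ 1 / ((N : ℝ) + 1)) :
    Tendsto (fun N => coinMixture μ (τ N)) atTop (𝓝 μ) := by
  refine isPiSystem_cylinders.tendsto_probabilityMeasure_of_tendsto_of_mem ?_ ?_ ?_
  · rintro _ ⟨n, σ, rfl⟩
    exact measurableSet_cyl σ
  · intro u hu x hx
    obtain ⟨n, hn⟩ := exists_cyl_subset hu hx
    exact ⟨_, ⟨n, _, rfl⟩, (isClopen_cyl _).isOpen.mem_nhds fun i => rfl, hn⟩
  · rintro _ ⟨n, η, rfl⟩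
    rw [← NNReal.tendsto_coe]
    change Tendsto (fun N => (coinMixture μ (τ N) : Measure Realization).real (cyl η)) atTop
      (𝓝 ((μ : Measure Realization).real (cyl η)))
    -- The first error comes from moving each bias by at most `1 / (N + 1)` in `n` factors, the
    -- second from sampling with replacement.
    have hlim : Tendsto (fun N : ℕ => (n : ℝ) * (1 / ((N : ℝ) + 1)) +
        (1 - (N.descFactorial n : ℝ) / (N : ℝ) ^ n)) atTop (𝓝 0) := by
      have h1 : Tendsto (fun N : ℕ => (N.descFactorial n : ℝ) / (N : ℝ) ^ n) atTop (𝓝 1) := by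
        refine (Asymptotics.isEquivalent_iff_tendsto_one ?_).1 (isEquivalent_descFactorial n)
        filter_upwards [eventually_gt_atTop 0] with N hN
        positivity
      simpa using (tendsto_one_div_add_atTop_nhds_zero_nat.const_mul (n : ℝ)).add
        ((tendsto_const_nhds (x := (1 : ℝ))).sub h1)
    rw [tendsto_iff_dist_tendsto_zero]
    refine squeeze_zero' (Eventually.of_forall fun _ => dist_nonneg) ?_ hlim
    filter_upwards [eventually_gt_atTop 0] with N hN
    rw [Real.dist_eq]
    refine (abs_sub_le _ (∑ σ : Fin N → Fin 2, (μ : Measure Realization).real (cyl σ) *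
        ∏ i, coinWeight (meanOutcome σ) (η i)) _).trans
      (add_le_add ?_ (abs_sampling_sub_measureReal_cyl_le hμ hN η))
    rw [measureReal_coinMixture_cyl, ← Finset.sum_sub_distrib]
    refine (Finset.abs_sum_le_sum_abs _ _).trans ?_
    refine le_of_le_of_eq (b := ∑ σ : Fin N → Fin 2, (μ : Measure Realization).real (cyl σ) *
      ((n : ℝ) * (1 / ((N : ℝ) + 1)))) ?_ (by rw [← Finset.sum_mul, sum_measureReal_cyl, one_mul])
    refine Finset.sum_le_sum fun σ _ => ?_
    rw [← mul_sub, abs_mul, abs_of_nonneg measureReal_nonneg]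
    refine mul_le_mul_of_nonneg_left ?_ measureReal_nonneg
    refine (abs_prod_sub_prod_le _ (fun i => abs_coinWeight_le_one (τ N σ).2 _)
      fun i => abs_coinWeight_le_one (meanOutcome_mem_Icc σ) _).trans ?_
    simp_rw [abs_coinWeight_sub_coinWeight]
    simpa using mul_le_mul_of_nonneg_left (hτ N σ) (Nat.cast_nonneg n)

/-! ### Generic theories avoid closed nowhere dense sets -/

theorem exists_unitInterval_notMem {F : Set ℝ} (hF : interior F = ∅) {u : ℝ}
    (hu : u ∈ Set.Icc (0 : ℝ) 1) {ε : ℝ} (hε : 0 < ε) :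
    ∃ t : unitInterval, (t : ℝ) ∉ F ∧ |(t : ℝ) - u| ≤ ε := by
  -- The mean `u` may be an endpoint; moving first to `v` in the open interval keeps the final bias
  -- in the unit interval.
  have hcl : u ∈ closure (Set.Ioo (0 : ℝ) 1) := by
    rwa [closure_Ioo (zero_ne_one)]
  obtain ⟨v, hv, hvu⟩ := Metric.mem_closure_iff.1 hcl (ε / 2) (half_pos hε)
  have hd : Dense Fᶜ := interior_eq_empty_iff_dense_compl.1 hF
  have hopen : IsOpen (Set.Ioo (0 : ℝ) 1 ∩ Metric.ball v (ε / 2)) :=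
    isOpen_Ioo.inter Metric.isOpen_ball
  obtain ⟨t, ⟨ht, htv⟩, htF⟩ := hd.inter_open_nonempty _ hopen
    ⟨v, hv, Metric.mem_ball_self (half_pos hε)⟩
  refine ⟨⟨t, ht.1.le, ht.2.le⟩, htF, ?_⟩
  rw [Metric.mem_ball, Real.dist_eq] at htv
  rw [Real.dist_eq, abs_sub_comm] at hvu
  have := abs_sub_le t v u
  change |t - u| ≤ ε
  linarith

/-- Clopen sets have empty boundary, so their probability is weak-* continuous. -/
theorem isOpen_setOf_measure_lt {C : Set Realization} (hC : IsClopen C) (ε : ENNReal) :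
    IsOpen {μ : Theory | (μ : Measure Realization) C < ε} := by
  have hcont : Continuous fun μ : Theory => (μ : Measure Realization) C := by
    refine continuous_iff_continuousAt.2 fun μ => ?_
    have h := ProbabilityMeasure.tendsto_measure_of_isClopen_of_tendsto
      (tendsto_id : Tendsto id (𝓝 μ) (𝓝 μ)) hC
    simpa [ContinuousAt] using ENNReal.tendsto_coe.2 h
  exact isOpen_Iio.preimage hcont

/-- A generic exchangeable theory assigns probability zero to limiting frequencies in a closed
nowhere dense set. -/
theorem residual_measure_limitFrequency_mem_eq_zero {F : Set ℝ} (hF : IsClosed F)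
    (hint : interior F = ∅) :
    {μ : exchangeable | ((μ : Theory) : Measure Realization) {x | limitFrequency x ∈ F} = 0} ∈
      residual exchangeable := by
  -- Requiring `K ≥ j` keeps the error of the finite approximation below `2 * 2⁻¹ ^ j`, whence the
  -- total `3 * 2⁻¹ ^ j` further on.
  have hmem : ∀ j : ℕ, (⋃ K ≥ j, {μ : exchangeable | ((μ : Theory) : Measure Realization)
      {x | frequency (8 ^ K) x ∈ fattening F K} < (2⁻¹ : ENNReal) ^ j}) ∈
      residual exchangeable := by
    intro j
    refine residual_of_dense_open (isOpen_biUnion fun K _ =>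
      (isOpen_setOf_measure_lt (isClopen_frequency_mem _ _) _).preimage continuous_subtype_val) ?_
    intro μ
    -- Perturbing the empirical biases out of `F` gives mixtures that converge to `μ`. Each has
    -- finitely many components, all of whose frequencies stay away from `F`.
    choose t ht htu using fun (N : ℕ) (σ : Fin N → Fin 2) =>
      exists_unitInterval_notMem hint (meanOutcome_mem_Icc σ)
        (ε := 1 / ((N : ℝ) + 1)) Nat.one_div_pos_of_nat
    have hlim : Tendsto (fun N => (⟨coinMixture μ (t N), coinMixture_mem_exchangeable μ (t N)⟩ :
        exchangeable)) atTop (𝓝 μ) :=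
      tendsto_subtype_rng.2 (tendsto_coinMixture μ.2 t htu)
    refine mem_closure_of_tendsto hlim (Eventually.of_forall fun N => ?_)
    have hzero : Tendsto (fun K => (coinMixture μ (t N) : Measure Realization)
        {x | frequency (8 ^ K) x ∈ fattening F K}) atTop (𝓝 0) := by
      simp_rw [coinMixture_apply]
      have h := tendsto_finsetSum (Finset.univ : Finset (Fin N → Fin 2)) fun σ _ =>
        ENNReal.Tendsto.const_mul (a := ((μ : Theory) : Measure Realization) (cyl σ))
          (tendsto_iid_frequency_mem_fattening hF (ht N σ)) (Or.inr (measure_ne_top _ _))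
      simpa using h
    have hpos : (0 : ENNReal) < 2⁻¹ ^ j := ENNReal.pow_pos (by simp) j
    obtain ⟨K, hK, hKj⟩ := ((hzero.eventually_lt_const hpos).and (eventually_ge_atTop j)).exists
    exact Set.mem_biUnion hKj hK
  filter_upwards [countable_iInter_mem.2 hmem] with μ hμ
  have hbound : ∀ j : ℕ, ((μ : Theory) : Measure Realization) {x | limitFrequency x ∈ F} ≤
      (2⁻¹ : ENNReal) ^ j * 3 := by
    intro j
    obtain ⟨K, hK, hlt⟩ := Set.mem_iUnion₂.1 (Set.mem_iInter.1 hμ j)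
    calc _ ≤ _ := measure_limitFrequency_mem_le μ.2 F K
      _ ≤ (2⁻¹ : ENNReal) ^ j + (2⁻¹ : ENNReal) ^ j * 2 :=
        add_le_add hlt.le (mul_le_mul_left (pow_le_pow_right_of_le_one' (by simp) hK) 2)
      _ = _ := by ring
  have hlim : Tendsto (fun j : ℕ => (2⁻¹ : ENNReal) ^ j * 3) atTop (𝓝 0) := by
    have h := ENNReal.Tendsto.mul_const (b := 3)
      (ENNReal.tendsto_pow_atTop_nhds_zero_of_lt_one (r := 2⁻¹) (by simp)) (Or.inr (by simp))
    simpa using h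
  exact le_antisymm (ge_of_tendsto' hlim hbound) zero_le

/-! ### Plausible limiting frequencies -/

/-- An enumeration of the rational numbers. -/
def rationalSeq (i : ℕ) : ℝ := ((Denumerable.eqv ℚ).symm i : ℚ)

theorem exists_rationalSeq_eq (q : ℚ) : ∃ i, rationalSeq i = q :=
  ⟨Denumerable.eqv ℚ q, by simp [rationalSeq]⟩

/-- The event that the limiting frequency is close to the `i`-th rational but different from it. -/
def punctured (i n : ℕ) : Set Realization :=
  {x | 0 < |limitFrequency x - rationalSeq i| ∧
    |limitFrequency x - rationalSeq i| < 1 / ((n : ℝ) + 1)}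

theorem measurableSet_punctured (i n : ℕ) : MeasurableSet (punctured i n) := by
  have h : Measurable fun x => |limitFrequency x - rationalSeq i| :=
    continuous_abs.measurable.comp (measurable_limitFrequency.sub_const _)
  exact (measurableSet_lt measurable_const h).inter (measurableSet_lt h measurable_const)

theorem punctured_antitone (i : ℕ) : Antitone (punctured i) := fun _ _ h _ hx =>
  ⟨hx.1, hx.2.trans_le (Nat.one_div_le_one_div h)⟩

theorem iInter_punctured (i : ℕ) : ⋂ n, punctured i n = ∅ := by
  refine Set.eq_empty_of_forall_notMem fun x hx => ?_
  rw [Set.mem_iInter] at hx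
  obtain ⟨n, hn⟩ := exists_nat_one_div_lt (hx 0).1
  exact lt_asymm hn (hx n).2

/-- Without its centre the ball shrinks to the empty set, so atoms of the law at rationals do no
harm. -/
theorem tendsto_measure_punctured (ν : Measure Realization) [IsFiniteMeasure ν] (i : ℕ) :
    Tendsto (fun n => ν (punctured i n)) atTop (𝓝 0) := by
  have h := tendsto_measure_iInter_atTop (μ := ν)
    (fun n => (measurableSet_punctured i n).nullMeasurableSet) (punctured_antitone i)
    ⟨0, measure_ne_top _ _⟩
  rwa [iInter_punctured, measure_empty] at h

/-- The point `t` avoids the largest balls around rationals whose punctured versions have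
sufficiently small probability under `ν`. -/
def AvoidsRationals (ν : Theory) (k : ℕ) (t : ℝ) : Prop :=
  ∀ i n, (ν : Measure Realization) (punctured i n) ≤ (2⁻¹ : ENNReal) ^ (i + k) →
    1 / ((n : ℝ) + 1) ≤ |t - rationalSeq i|

/-- The realization `x` has a limiting frequency in a meager set that carries the limiting
frequency under `ν`. -/
def Plausible (ν : Theory) (x : Realization) : Prop :=
  (∃ i, limitFrequency x = rationalSeq i) ∨ ∃ k, AvoidsRationals ν k (limitFrequency x)

theorem tsum_two_inv_pow_add (k : ℕ) : ∑' i : ℕ, (2⁻¹ : ENNReal) ^ (i + k) = 2 * 2⁻¹ ^ k := by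
  simp_rw [pow_add]
  rw [ENNReal.tsum_mul_right, ENNReal.tsum_geometric, ENNReal.one_sub_inv_two, inv_inv]

theorem tendsto_two_mul_two_inv_pow :
    Tendsto (fun k : ℕ => 2 * (2⁻¹ : ENNReal) ^ k) atTop (𝓝 0) := by
  have h := ENNReal.Tendsto.const_mul (a := 2)
    (ENNReal.tendsto_pow_atTop_nhds_zero_of_lt_one (r := 2⁻¹) (by simp)) (Or.inr (by simp))
  simpa using h

theorem measure_not_plausible (ν : Theory) :
    (ν : Measure Realization) {x | ¬ Plausible ν x} = 0 := by
  classical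
  refine le_antisymm (ge_of_tendsto' tendsto_two_mul_two_inv_pow fun k => ?_) zero_le
  have hex : ∀ i, ∃ n, (ν : Measure Realization) (punctured i n) ≤ (2⁻¹ : ENNReal) ^ (i + k) :=
    fun i => (((tendsto_measure_punctured (ν : Measure Realization) i).eventually_lt_const
      (ENNReal.pow_pos (by simp) (i + k))).exists).imp fun _ h => h.le
  -- The least admissible `n` gives the largest ball, which contains every admissible ball that `x`
  -- could violate.
  have hsub : {x | ¬ Plausible ν x} ⊆ ⋃ i, punctured i (Nat.find (hex i)) := by
    intro x hx
    simp only [Plausible, AvoidsRationals, Set.mem_ofPred_eq, not_or, not_exists, not_forall,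
      not_le] at hx
    obtain ⟨hne, hk⟩ := hx
    obtain ⟨i, n, hn, hlt⟩ := hk k
    exact Set.mem_iUnion.2 ⟨i, abs_pos.2 (sub_ne_zero.2 (hne i)),
      hlt.trans_le (Nat.one_div_le_one_div (Nat.find_min' (hex i) hn))⟩
  calc _ ≤ _ := measure_mono hsub
    _ ≤ _ := measure_iUnion_le _
    _ ≤ ∑' i : ℕ, (2⁻¹ : ENNReal) ^ (i + k) := ENNReal.tsum_le_tsum fun i => Nat.find_spec (hex i)
    _ = _ := tsum_two_inv_pow_add k

theorem measurable_measure_theory {s : Set Realization} (hs : MeasurableSet s) :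
    Measurable fun ν : exchangeable => ((ν : Theory) : Measure Realization) s :=
  (Measure.measurable_coe hs).comp (measurable_subtype_coe.comp measurable_subtype_coe)

theorem isClosed_setOf_le_abs_sub_rationalSeq (r : ℕ → ℝ) :
    IsClosed {t : ℝ | ∀ i, r i ≤ |t - rationalSeq i|} := by
  rw [Set.ofPred_forall]
  exact isClosed_iInter fun i => isClosed_le continuous_const (by fun_prop)

/-- With positive radii the set contains no rational. -/
theorem interior_setOf_le_abs_sub_rationalSeq {r : ℕ → ℝ} (hr : ∀ i, 0 < r i) :
    interior {t : ℝ | ∀ i, r i ≤ |t - rationalSeq i|} = ∅ := by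
  rw [interior_eq_empty_iff_dense_compl]
  refine Rat.denseRange_cast.mono ?_
  rintro _ ⟨q, rfl⟩ h
  obtain ⟨i, hi⟩ := exists_rationalSeq_eq q
  have := h i
  rw [hi, sub_self, abs_zero] at this
  exact this.not_gt (hr i)

theorem tendsto_measure_setOf_lt_measure_punctured (ζ : Measure exchangeable) [IsFiniteMeasure ζ]
    (i : ℕ) {ε : ENNReal} (hε : 0 < ε) :
    Tendsto (fun n => ζ {ν | ε < ((ν : Theory) : Measure Realization) (punctured i n)}) atTop
      (𝓝 0) := by
  have h := tendsto_measure_iInter_atTop (μ := ζ)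
    (s := fun n => {ν : exchangeable | ε < ((ν : Theory) : Measure Realization) (punctured i n)})
    (fun n => (measurableSet_lt measurable_const
      (measurable_measure_theory (measurableSet_punctured i n))).nullMeasurableSet)
    (fun n m hnm ν hν => lt_of_lt_of_le hν (measure_mono (punctured_antitone i hnm)))
    ⟨0, measure_ne_top _ _⟩
  have hempty : ⋂ n, {ν : exchangeable | ε < ((ν : Theory) : Measure Realization) (punctured i n)} =
      ∅ := by
    refine Set.eq_empty_of_forall_notMem fun ν hν => ?_
    obtain ⟨n, hn⟩ := ((tendsto_measure_punctured ((ν : Theory) : Measure Realization)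
      i).eventually_lt_const hε).exists
    exact lt_asymm hn (Set.mem_iInter.1 hν n)
  rwa [hempty, measure_empty] at h

/-- Against a generic exchangeable theory, a randomly chosen theory is plausible with probability
zero. -/
theorem residual_prod_plausible_eq_zero (ζ : Measure exchangeable) [IsProbabilityMeasure ζ] :
    {μ : exchangeable | (ζ.prod ((μ : Theory) : Measure Realization))
      {z : exchangeable × Realization | Plausible z.1 z.2} = 0} ∈ residual exchangeable := by
  have hpow : ∀ m : ℕ, (0 : ENNReal) < 2⁻¹ ^ m := fun m => ENNReal.pow_pos (by simp) m
  -- Deterministic radii: `1 / (N k j i + 1)` is admissible at level `k` for all `ν` outside a set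
  -- of `ζ`-probability below `2⁻¹ ^ (i + j)`, which sums over `i` to at most `2 * 2⁻¹ ^ j`.
  choose N hN using fun k j i : ℕ => (((tendsto_measure_setOf_lt_measure_punctured ζ i
    (hpow (i + k))).eventually_lt_const (hpow (i + j))).exists)
  have hgen1 := countable_iInter_mem.2 fun k => countable_iInter_mem.2 fun j =>
    residual_measure_limitFrequency_mem_eq_zero
      (isClosed_setOf_le_abs_sub_rationalSeq fun i => 1 / ((N k j i : ℝ) + 1))
      (interior_setOf_le_abs_sub_rationalSeq fun i => Nat.one_div_pos_of_nat)
  have hgen2 := countable_iInter_mem.2 fun i =>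
    residual_measure_limitFrequency_mem_eq_zero (isClosed_singleton (x := rationalSeq i))
      (interior_singleton _)
  filter_upwards [hgen1, hgen2] with μ h1 h2
  simp only [Set.mem_iInter, Set.mem_ofPred_eq] at h1 h2
  have hsub : {z : exchangeable × Realization | Plausible z.1 z.2} ⊆
      (⋃ i, Set.univ ×ˢ {x | limitFrequency x ∈ ({rationalSeq i} : Set ℝ)}) ∪
        ⋃ k, {z | AvoidsRationals z.1 k (limitFrequency z.2)} := by
    rintro z (⟨i, hi⟩ | ⟨k, hk⟩)
    · exact Or.inl (Set.mem_iUnion.2 ⟨i, Set.mem_univ _, hi⟩)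
    · exact Or.inr (Set.mem_iUnion.2 ⟨k, hk⟩)
  refine measure_mono_null hsub (measure_union_null (measure_iUnion_null fun i => ?_)
    (measure_iUnion_null fun k => ?_))
  · rw [Measure.prod_prod, h2 i, mul_zero]
  · refine le_antisymm (ge_of_tendsto' tendsto_two_mul_two_inv_pow fun j => ?_) zero_le
    -- If all the deterministic radii are admissible for `ν`, avoidance forces the limiting
    -- frequency into a closed nowhere dense set that does not depend on `ν`.
    have hcover : {z : exchangeable × Realization | AvoidsRationals z.1 k (limitFrequency z.2)} ⊆
        (⋃ i, {ν : exchangeable | (2⁻¹ : ENNReal) ^ (i + k) <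
            ((ν : Theory) : Measure Realization) (punctured i (N k j i))} ×ˢ Set.univ) ∪
          Set.univ ×ˢ {x | limitFrequency x ∈
            {t : ℝ | ∀ i, 1 / ((N k j i : ℝ) + 1) ≤ |t - rationalSeq i|}} := by
      intro z hz
      by_cases h : ∀ i, ((z.1 : Theory) : Measure Realization) (punctured i (N k j i)) ≤
          (2⁻¹ : ENNReal) ^ (i + k)
      · exact Or.inr ⟨Set.mem_univ _, fun i => hz i _ (h i)⟩
      · push Not at h
        obtain ⟨i, hi⟩ := h
        exact Or.inl (Set.mem_iUnion.2 ⟨i, hi, Set.mem_univ _⟩)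
    refine (measure_mono hcover).trans ((measure_union_le _ _).trans ?_)
    have hnull : ((μ : Theory) : Measure Realization) {x | limitFrequency x ∈
        {t : ℝ | ∀ i, 1 / ((N k j i : ℝ) + 1) ≤ |t - rationalSeq i|}} = 0 := h1 k j
    rw [Measure.prod_prod, hnull, mul_zero, add_zero, ← tsum_two_inv_pow_add]
    refine (measure_iUnion_le _).trans (ENNReal.tsum_le_tsum fun i => ?_)
    rw [Measure.prod_prod, measure_univ, mul_one]
    exact (hN k j i).le

/-! ### Reconstruction of an exchangeable theory from its forecasts -/

theorem realization_eq_generateFrom_cylinders :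
    (inferInstance : MeasurableSpace Realization) = .generateFrom cylinders := by
  have hbasis : TopologicalSpace.IsTopologicalBasis cylinders :=
    TopologicalSpace.isTopologicalBasis_of_isOpen_of_nhds
      (by rintro _ ⟨n, σ, rfl⟩; exact (isClopen_cyl σ).isOpen)
      fun x u hx hu => by
        obtain ⟨n, hn⟩ := exists_cyl_subset hu hx
        exact ⟨_, ⟨n, _, rfl⟩, fun i => rfl, hn⟩
  exact (BorelSpace.measurable_eq (α := Realization)).trans hbasis.borel_eq_generateFrom

/-- The number of periods with outcome `1`. -/
def countOnes {n : ℕ} (σ : Fin n → Fin 2) : ℕ := ∑ i, if σ i = 1 then 1 else 0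

theorem countOnes_le {n : ℕ} (σ : Fin n → Fin 2) : countOnes σ ≤ n := by
  refine (Finset.sum_le_card_nsmul _ _ 1 fun i _ => ?_).trans_eq (by simp)
  split_ifs <;> simp

theorem countOnes_snoc {n : ℕ} (σ : Fin n → Fin 2) (s : Fin 2) :
    countOnes (Fin.snoc σ s : Fin (n + 1) → Fin 2) = countOnes σ + if s = 1 then 1 else 0 := by
  rw [countOnes, Fin.sum_univ_castSucc]
  simp only [Fin.snoc_castSucc, Fin.snoc_last]
  rfl

theorem measure_cyl_eq_of_countOnes_eq {μ : Theory} (hμ : μ ∈ exchangeable) {n : ℕ}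
    {σ τ : Fin n → Fin 2} (h : countOnes σ = countOnes τ) :
    (μ : Measure Realization).real (cyl σ) = (μ : Measure Realization).real (cyl τ) := by
  rw [measureReal_def, measureReal_def,
    measure_cyl_eq_of_card_eq hμ (σ := σ) (τ := τ)
      (by rwa [Finset.card_filter, Finset.card_filter])]

/-- The finite sequence that consists of `a` ones followed by zeros. -/
def leadingOnes (n a : ℕ) : Fin n → Fin 2 := fun i => if (i : ℕ) < a then 1 else 0

theorem countOnes_leadingOnes {n a : ℕ} (h : a ≤ n) : countOnes (leadingOnes n a) = a := by
  have hval : ∀ i : Fin n, (if leadingOnes n a i = 1 then 1 else 0) =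
      if (i : ℕ) < a then 1 else 0 := by
    intro i
    by_cases hi : (i : ℕ) < a
    · rw [leadingOnes, if_pos hi, if_pos rfl, if_pos hi]
    · rw [leadingOnes, if_neg hi, if_neg zero_ne_one, if_neg hi]
  rw [countOnes, Finset.sum_congr rfl fun i _ => hval i,
    Fin.sum_univ_eq_sum_range (fun i => if i < a then 1 else 0), ← Finset.sum_filter]
  have : (Finset.range n).filter (· < a) = Finset.range a := by
    ext i
    simp only [Finset.mem_range, Finset.mem_filter]
    omega
  simp [this]

/-- The probability of observing `a` ones and `n - a` zeros in a given order. -/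
noncomputable def profile (μ : Theory) (n a : ℕ) : ℝ :=
  if a ≤ n then (μ : Measure Realization).real (cyl (leadingOnes n a)) else 0

theorem measureReal_cyl_eq_profile {μ : Theory} (hμ : μ ∈ exchangeable) {n : ℕ}
    (σ : Fin n → Fin 2) : (μ : Measure Realization).real (cyl σ) = profile μ n (countOnes σ) := by
  rw [profile, if_pos (countOnes_le σ)]
  exact measure_cyl_eq_of_countOnes_eq hμ (countOnes_leadingOnes (countOnes_le σ)).symm

theorem measureReal_cyl_eq_add (μ : Theory) {n : ℕ} (σ : Fin n → Fin 2) :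
    (μ : Measure Realization).real (cyl σ) =
      (μ : Measure Realization).real (cyl (Fin.snoc σ 0 : Fin (n + 1) → Fin 2)) +
        (μ : Measure Realization).real (cyl (Fin.snoc σ 1 : Fin (n + 1) → Fin 2)) := by
  rw [← measureReal_union ?_ (measurableSet_cyl _)]
  · congr 1
    ext x
    have hs : x n = 0 ∨ x n = 1 := by
      generalize x n = s
      revert s
      decide
    simp only [cyl, Set.mem_union, Set.mem_ofPred_eq, Fin.forall_fin_succ', Fin.snoc_castSucc,
      Fin.snoc_last, Fin.val_castSucc, Fin.val_last]
    tauto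
  · refine Set.disjoint_left.2 fun x hx hx' => ?_
    have h0 := hx (Fin.last n)
    have h1 := hx' (Fin.last n)
    rw [Fin.snoc_last] at h0 h1
    exact zero_ne_one (h0.symm.trans h1)

theorem profile_eq_add {μ : Theory} (hμ : μ ∈ exchangeable) {n a : ℕ} (h : a ≤ n) :
    profile μ n a = profile μ (n + 1) a + profile μ (n + 1) (a + 1) := by
  have h1 := measureReal_cyl_eq_add μ (leadingOnes n a)
  simpa [measureReal_cyl_eq_profile hμ, countOnes_snoc, countOnes_leadingOnes h] using h1

/-- Unrolls the relation `profile_eq_add` along a row. Given row `n`, any single entry of row `n +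
1` therefore determines that whole row. -/
theorem neg_one_pow_mul_profile {μ : Theory} (hμ : μ ∈ exchangeable) {n a : ℕ} (h : a ≤ n + 1) :
    (-1) ^ a * profile μ (n + 1) a =
      profile μ (n + 1) 0 - ∑ i ∈ Finset.range a, (-1) ^ i * profile μ n i := by
  induction a with
  | zero => simp
  | succ a ih =>
    rw [Finset.sum_range_succ, ← sub_sub, ← ih (by omega),
      profile_eq_add hμ (show a ≤ n by omega)]
    ring

/-- The probability assigned by a sequence of forecasts to the first `n` outcomes. -/
noncomputable def forecastProb (y : ℕ → unitInterval × Fin 2) (n : ℕ) : ℝ :=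
  ∏ k ∈ Finset.range n, coinWeight (y k).1 (y k).2

/-- The number of outcomes `1` among the first `n`. -/
def onesBefore (y : ℕ → unitInterval × Fin 2) (n : ℕ) : ℕ :=
  ∑ k ∈ Finset.range n, if (y k).2 = 1 then 1 else 0

/-- The profile of an exchangeable theory, reconstructed from its forecasts along one realization:
the last forecast determines one entry of the new row, and the alternating sums of the
previous row determine the others. -/
noncomputable def reconstructedProfile (y : ℕ → unitInterval × Fin 2) : ℕ → ℕ → ℝ
  | 0, a => if a ≤ 0 then 1 else 0
  | n + 1, a =>
    if a ≤ n + 1 then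
      -- The product of `forecastProb` and the forecast is the entry at `onesBefore y n + 1`,
      -- whichever outcome occurs. The first sum carries it back to entry `0`, the second on to
      -- entry `a`. The first sum has a fixed range because its true upper limit varies with `y`.
      (-1) ^ a * ((-1) ^ (onesBefore y n + 1) * (forecastProb y n * (y n).1) +
        (∑ i ∈ Finset.range (n + 1),
          if i < onesBefore y n + 1 then (-1) ^ i * reconstructedProfile y n i else 0) -
        ∑ i ∈ Finset.range a, (-1) ^ i * reconstructedProfile y n i)
    else 0

theorem measurable_reconstructedProfile (n a : ℕ) :
    Measurable fun y => reconstructedProfile y n a := by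
  have hs : ∀ k, Measurable fun y : ℕ → unitInterval × Fin 2 => (y k).2 := fun k =>
    measurable_snd.comp (measurable_pi_apply k)
  have hp : ∀ k, Measurable fun y : ℕ → unitInterval × Fin 2 => ((y k).1 : ℝ) := fun k =>
    measurable_subtype_coe.comp (measurable_fst.comp (measurable_pi_apply k))
  have hset : ∀ k, MeasurableSet {y : ℕ → unitInterval × Fin 2 | (y k).2 = 1} := fun k =>
    measurableSet_eq_fun (hs k) measurable_const
  have hones : ∀ n, Measurable fun y => onesBefore y n := fun n =>
    Finset.measurable_sum _ fun k _ => Measurable.ite (hset k) measurable_const measurable_const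
  have hprob : ∀ n, Measurable fun y => forecastProb y n := fun n =>
    Finset.measurable_prod _ fun k _ =>
      Measurable.ite (hset k) (hp k) (measurable_const.sub (hp k))
  induction n generalizing a with
  | zero => exact measurable_const
  | succ n ih =>
    simp only [reconstructedProfile]
    split_ifs with h
    · refine ((((measurable_const.pow ((hones n).add_const 1)).mul
        ((hprob n).mul (hp n))).add (Finset.measurable_sum _ fun i _ => Measurable.ite
          (measurableSet_lt measurable_const ((hones n).add_const 1))
          ((ih i).const_mul _) measurable_const)).sub
        (Finset.measurable_sum _ fun i _ => (ih i).const_mul _)).const_mul _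
    · exact measurable_const

theorem initialSegment_succ (x : Realization) (n : ℕ) :
    initialSegment x (n + 1) = Fin.snoc (initialSegment x n) (x n) := by
  funext i
  refine Fin.lastCases ?_ (fun i => ?_) i
  · simp [initialSegment]
  · simp [initialSegment]

theorem measureReal_cyl_mul_forecast {μ : Theory} {x : Realization} {n : ℕ}
    (h : 0 < (μ : Measure Realization) (cyl (initialSegment x n))) :
    (μ : Measure Realization).real (cyl (initialSegment x n)) * (forecast μ x n : ℝ) =
      (μ : Measure Realization).real
        (cyl (Fin.snoc (initialSegment x n) 1 : Fin (n + 1) → Fin 2)) :=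
  mul_div_cancel₀ _ (ENNReal.toReal_pos h.ne' (measure_ne_top _ _)).ne'

theorem forecastProb_eq {μ : Theory} {x : Realization}
    (h : ∀ n, 0 < (μ : Measure Realization) (cyl (initialSegment x n))) (n : ℕ) :
    forecastProb (fun n => (forecast μ x n, x n)) n =
      (μ : Measure Realization).real (cyl (initialSegment x n)) := by
  induction n with
  | zero =>
    have : cyl (initialSegment x 0) = Set.univ := by
      ext z
      simp [cyl]
    simp [forecastProb, this]
  | succ n ih =>
    have h1 := measureReal_cyl_mul_forecast (h n)
    have h2 := measureReal_cyl_eq_add μ (initialSegment x n)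
    have hs : ∀ s : Fin 2, s = 0 ∨ s = 1 := by decide
    rw [forecastProb, Finset.prod_range_succ, ← forecastProb, ih, initialSegment_succ]
    rcases hs (x n) with hx | hx
    · simp only [hx, coinWeight, zero_ne_one, if_false]
      rw [mul_sub, h1, mul_one]
      linarith
    · simp only [hx, coinWeight, if_true]
      exact h1

theorem onesBefore_eq (p : ℕ → unitInterval) (x : Realization) (n : ℕ) :
    onesBefore (fun n => (p n, x n)) n = countOnes (initialSegment x n) :=
  Finset.sum_range _

theorem reconstructedProfile_eq {μ : Theory} (hμ : μ ∈ exchangeable) {x : Realization}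
    (h : ∀ n, 0 < (μ : Measure Realization) (cyl (initialSegment x n))) (n a : ℕ) :
    reconstructedProfile (fun n => (forecast μ x n, x n)) n a = profile μ n a := by
  induction n generalizing a with
  | zero =>
    have : cyl (leadingOnes 0 a) = Set.univ := by
      ext z
      simp [cyl]
    simp [reconstructedProfile, profile, this]
  | succ n ih =>
    simp only [reconstructedProfile, onesBefore_eq]
    split_ifs with ha
    · simp_rw [ih]
      rw [forecastProb_eq h, measureReal_cyl_mul_forecast (h n), measureReal_cyl_eq_profile hμ,
        countOnes_snoc, if_pos rfl]
      -- At most `n` ones have occurred, so the fixed range cuts nothing off.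
      have hle := countOnes_le (initialSegment x n)
      have hfilter : (Finset.range (n + 1)).filter (· < countOnes (initialSegment x n) + 1) =
          Finset.range (countOnes (initialSegment x n) + 1) := by
        ext i
        simp only [Finset.mem_range, Finset.mem_filter]
        omega
      rw [← Finset.sum_filter, hfilter, neg_one_pow_mul_profile hμ (by omega), sub_add_cancel,
        ← neg_one_pow_mul_profile hμ ha, ← mul_assoc, ← mul_pow]
      simp
    · rw [profile, if_neg ha]

/-! ### The test and the conclusion -/

theorem measurable_theory_comap_profile :
    Measurable[MeasurableSpace.comap (fun ν : exchangeable => profile ν) inferInstance]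
      fun ν : exchangeable => ((ν : Theory) : Measure Realization) := by
  let _ : MeasurableSpace exchangeable :=
    MeasurableSpace.comap (fun ν : exchangeable => profile ν) inferInstance
  refine Measurable.measure_of_isPiSystem_of_isProbabilityMeasure
    realization_eq_generateFrom_cylinders isPiSystem_cylinders ?_
  rintro _ ⟨n, σ, rfl⟩
  have h : (fun ν : exchangeable => ((ν : Theory) : Measure Realization) (cyl σ)) =
      fun ν : exchangeable => ENNReal.ofReal (profile ν n (countOnes σ)) := by
    funext ν
    rw [← measureReal_cyl_eq_profile ν.2, ofReal_measureReal]
  rw [h]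
  have h1 : Measurable fun w : ℕ → ℕ → ℝ => ENNReal.ofReal (w n (countOnes σ)) :=
    ENNReal.measurable_ofReal.comp ((measurable_pi_apply _).comp (measurable_pi_apply n))
  exact h1.comp (comap_measurable fun ν : exchangeable => profile ν)

/-- Profiles determine cylinder probabilities, and these generate all events; bounds on `ν s` thus
become Borel conditions on the reconstructed profile. -/
theorem exists_measurableSet_profile_mem_iff {s : Set Realization} (hs : MeasurableSet s)
    (ε : ENNReal) : ∃ D : Set (ℕ → ℕ → ℝ), MeasurableSet D ∧ ∀ ν ∈ exchangeable,
      profile ν ∈ D ↔ (ν : Measure Realization) s ≤ ε := by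
  obtain ⟨D, hD, hDeq⟩ : MeasurableSet[MeasurableSpace.comap
      (fun ν : exchangeable => profile ν) inferInstance]
      {ν : exchangeable | ((ν : Theory) : Measure Realization) s ≤ ε} := by
    let _ : MeasurableSpace exchangeable :=
      MeasurableSpace.comap (fun ν : exchangeable => profile ν) inferInstance
    exact measurableSet_le ((Measure.measurable_coe hs).comp measurable_theory_comap_profile)
      measurable_const
  refine ⟨D, hD, fun ν hν => ?_⟩
  exact Set.ext_iff.1 hDeq ⟨ν, hν⟩

/-- Plausibility of an exchangeable theory can be tested prequentially. -/
theorem exists_prequentialTest_iff_plausible :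
    ∃ T : PrequentialTest, ∀ ν ∈ exchangeable, ∀ x : Realization,
      (∀ n, 0 < (ν : Measure Realization) (cyl (initialSegment x n))) →
        (T.verdict (fun n => (forecast ν x n, x n)) = Verdict.pass ↔ Plausible ν x) := by
  classical
  choose D hD hDiff using fun k i n : ℕ =>
    exists_measurableSet_profile_mem_iff (measurableSet_punctured i n) ((2⁻¹ : ENNReal) ^ (i + k))
  -- Plausibility with the theory replaced by its reconstruction; the implication in
  -- `AvoidsRationals` becomes a union with a complement.
  let accept : Set (ℕ → unitInterval × Fin 2) :=
    (⋃ i, {y | limitFrequency (fun n => (y n).2) = rationalSeq i}) ∪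
      ⋃ k, ⋂ i, ⋂ n, {y | reconstructedProfile y ∈ D k i n}ᶜ ∪
        {y | 1 / ((n : ℝ) + 1) ≤ |limitFrequency (fun n => (y n).2) - rationalSeq i|}
  have hL : Measurable fun y : ℕ → unitInterval × Fin 2 => limitFrequency fun n => (y n).2 :=
    measurable_limitFrequency.comp
      (measurable_pi_lambda _ fun n => measurable_snd.comp (measurable_pi_apply n))
  have hW : Measurable reconstructedProfile :=
    measurable_pi_lambda _ fun n => measurable_pi_lambda _ fun a =>
      measurable_reconstructedProfile n a
  have haccept : MeasurableSet accept :=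
    (MeasurableSet.iUnion fun i => measurableSet_eq_fun hL measurable_const).union <|
      MeasurableSet.iUnion fun k => MeasurableSet.iInter fun i => MeasurableSet.iInter fun n =>
        (hW (hD k i n)).compl.union (measurableSet_le measurable_const
          (continuous_abs.measurable.comp (hL.sub_const _)))
  refine ⟨⟨fun y => if y ∈ accept then Verdict.pass else Verdict.fail,
    Measurable.ite haccept measurable_const measurable_const⟩, fun ν hν x hx => ?_⟩
  have hprofile : reconstructedProfile (fun n => (forecast ν x n, x n)) = profile ν :=
    funext fun n => funext fun a => reconstructedProfile_eq hν hx n a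
  have hmem : (fun n => (forecast ν x n, x n)) ∈ accept ↔ Plausible ν x := by
    simp only [accept, Plausible, AvoidsRationals, Set.mem_union, Set.mem_iUnion, Set.mem_iInter,
      Set.mem_compl_iff, Set.mem_ofPred_eq, hprofile, hDiff _ _ _ ν hν, imp_iff_not_or]
  rw [← hmem]
  change (if _ ∈ accept then Verdict.pass else Verdict.fail) = Verdict.pass ↔ _
  split_ifs with h <;> simp [h]

/-- The exceptional realizations lie in a countable union of null cylinders. -/
theorem measure_not_forall_cyl_pos (μ : Theory) :
    (μ : Measure Realization)
      {x | ¬ ∀ n, 0 < (μ : Measure Realization) (cyl (initialSegment x n))} = 0 := by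
  have hsub : {x | ¬ ∀ n, 0 < (μ : Measure Realization) (cyl (initialSegment x n))} ⊆
      ⋃ n, ⋃ σ ∈ {σ : Fin n → Fin 2 | (μ : Measure Realization) (cyl σ) = 0}, cyl σ := by
    intro x hx
    simp only [Set.mem_ofPred_eq, not_forall, not_lt, nonpos_iff_eq_zero] at hx
    obtain ⟨n, hn⟩ := hx
    exact Set.mem_iUnion.2 ⟨n, Set.mem_iUnion₂.2 ⟨initialSegment x n, hn, fun i => rfl⟩⟩
  exact measure_mono_null hsub (measure_iUnion_null fun n =>
    (measure_biUnion_null_iff (Set.to_countable _)).2 fun σ hσ => hσ)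

theorem theorem1 :
    ∃ T : PrequentialTest,
      AcceptsWithProbability T exchangeable 1 ∧ StronglyNonManipulable T exchangeable := by
  obtain ⟨T, hT⟩ := exists_prequentialTest_iff_plausible
  refine ⟨T, fun μ hμ => ?_, fun ζ => ?_⟩
  · have hnull := measure_union_null (measure_not_forall_cyl_pos μ) (measure_not_plausible μ)
    have hcompl : (acceptanceSet T μ)ᶜ ⊆
        {x | ¬ ∀ n, 0 < (μ : Measure Realization) (cyl (initialSegment x n))} ∪
          {x | ¬ Plausible μ x} := by
      intro x hx
      by_contra h
      simp only [Set.mem_union, Set.mem_ofPred_eq, not_or, not_not] at h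
      exact hx ⟨h.1, (hT μ hμ x h.1).2 h.2⟩
    have hae : ∀ᵐ x ∂(μ : Measure Realization), x ∈ acceptanceSet T μ :=
      measure_mono_null hcompl hnull
    exact (measure_univ (μ := (μ : Measure Realization))).symm.le.trans
      (measure_mono_ae (hae.mono fun x hx _ => hx))
  · filter_upwards [residual_prod_plausible_eq_zero (ζ : Measure exchangeable)] with μ hμ
    exact measure_mono_null (fun z hz => (hT z.1 z.1.2 z.2 hz.1).1 hz.2) hμ
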